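/- Let $n,D,w_{\min},\mu_{\max},D_\mu$ be real numbers with $n>0$ and $w_{\min}>0$. There are constants $C,C',C''>0$, depending only on these numbers, such that the following holds. Let $G=(V,E)$ be a (finite or infinite) simple graph in which every vertex has finitely many neighbours, with edge weights $w_{xy}>0$ for $x\sim y$ (not necessarily symmetric) and a measure $\mu:V\to(0,\infty)$. Put $$\deg(x)=\sum_{y\sim x}w_{xy},\qquad \Delta f(x)=\frac1{\mu(x)}\sum_{y\sim x}w_{xy}\,(f(y)-f(x)),$$ $$2\Gamma(f,g)=\Delta(fg)-f\,\Delta g-(\Delta f)\,g,\qquad 2\Gamma_2(f,g)=\Delta\Gamma(f,g)-\Gamma(f,\Delta g)-\Gamma(\Delta f,g),$$ $\Gamma(f)=\Gamma(f,f)$ and $\Gamma_2(f)=\Gamma_2(f,f)$. Suppose that $\deg(x)\le D$, $\mu(x)\le\mu_{\max}$ and $\deg(x)\le D_\mu\,\mu(x)$ for all $x\in V$, that $w_{xy}\ge w_{\min}$ whenever $x\sim y$, and that $G$ satisfies $CDE(n,0)$: for every $x\in V$ and every $f:V\to(0,\infty)$ with $\Delta f(x)<0$, $$\Gamma_2(f)(x)-\Gamma\Big(f,\frac{\Gamma(f)}{f}\Big)(x)\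 \ge\ \frac1n\,(\Delta f(x))^2 .$$ Let $P_t(x,y)=(e^{t\Delta}\mathbf 1_{\{y\}})(x)$ be the heat kernel, let $d$ be the graph distance ($d(x,y)=\infty$ if $x$ and $y$ lie in different connected components), $B(x,r)=\{z: d(x,z)\le r\}$ and $\mathrm{vol}(B(x,r))=\sum_{z\in B(x,r)}\mu(z)$. Then for all $t>1$: 1. for all $x,y\in V$ in the same connected component, $$C\,t^{-n}\exp\Big(-C'\,\frac{d(x,y)^2}{t-1}\Big)\ \le\ P_t(x,y);$$ 2. if the weights are symmetric ($w_{ab}=w_{ba}$ for all $a\sim b$), then for all $x,y\in V$, $$P_t(x,y)\ \le\ C''\,\frac{\mu(y)}{\mathrm{vol}(B(x,\sqrt t))}.$$ -/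

import Mathlib

/-- A locally finite weighted graph with a vertex measure: a simple graph on `V`, positive
(not necessarily symmetric) weights `w x y` on its edges and a positive measure `μ` on its
vertices. The values of `w` off the edges are never used. -/
structure WeightedGraph (V : Type*) where
  graph : SimpleGraph V
  w : V → V → ℝ
  μ : V → ℝ
  w_pos : ∀ x y, graph.Adj x y → 0 < w x y
  μ_pos : ∀ x, 0 < μ x
  locallyFinite : ∀ x, (graph.neighborSet x).Finite

namespace WeightedGraph

variable {V : Type*}

/-- The finite set of neighbours of `x`. -/
noncomputable def nbrs (G : WeightedGraph V) (x : V) : Finset V := (G.locallyFinite x).toFinset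

/-- The weighted degree `deg x = ∑_{y ∼ x} w x y`. -/
noncomputable def deg (G : WeightedGraph V) (x : V) : ℝ := ∑ y ∈ G.nbrs x, G.w x y

/-- The `μ`-Laplacian `Δ f (x) = (1 / μ x) ∑_{y ∼ x} w x y (f y - f x)`. -/
noncomputable def laplacian (G : WeightedGraph V) (f : V → ℝ) (x : V) : ℝ :=
  (1 / G.μ x) * ∑ y ∈ G.nbrs x, G.w x y * (f y - f x)

/-- The gradient form: `2 Γ(f, g) = Δ(f g) - f Δ g - (Δ f) g`. -/
noncomputable def Gam (G : WeightedGraph V) (f g : V → ℝ) (x : V) : ℝ :=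
  (G.laplacian (fun z => f z * g z) x - f x * G.laplacian g x - G.laplacian f x * g x) / 2

/-- The iterated gradient form: `2 Γ₂(f, g) = Δ Γ(f, g) - Γ(f, Δ g) - Γ(Δ f, g)`. -/
noncomputable def Gam2 (G : WeightedGraph V) (f g : V → ℝ) (x : V) : ℝ :=
  (G.laplacian (G.Gam f g) x - G.Gam f (G.laplacian g) x - G.Gam (G.laplacian f) g x) / 2

/-- The exponential curvature dimension inequality `CDE(x, n, K)` at the vertex `x`. -/
def CDEAt (G : WeightedGraph V) (x : V) (n K : ℝ) : Prop :=
  ∀ f : V → ℝ, (∀ z, 0 < f z) → G.laplacian f x < 0 →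
    (1 / n) * (G.laplacian f x) ^ 2 + K * G.Gam f f x ≤
      G.Gam2 f f x - G.Gam f (fun z => G.Gam f f z / f z) x

/-- The exponential curvature dimension inequality `CDE(n, K)`. -/
def CDE (G : WeightedGraph V) (n K : ℝ) : Prop := ∀ x, G.CDEAt x n K

/-- The heat kernel `P_t(x, y) = (e^{tΔ} 1_{y})(x)`, where
`e^{tΔ} = ∑ k, (t ^ k / k!) Δ ^ k`. The series converges absolutely when `deg / μ` is bounded,
see `WeightedGraph.summable_heatKernel`. -/
noncomputable def heatKernel (G : WeightedGraph V) (t : ℝ) (x y : V) : ℝ :=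
  ∑' k : ℕ, t ^ k / (k.factorial : ℝ) *
    (G.laplacian)^[k] (Set.indicator {y} (fun _ => (1 : ℝ))) x

/-- The closed ball of radius `r` around `x` for the graph distance (which is infinite between
different connected components). -/
def ball (G : WeightedGraph V) (x : V) (r : ℝ) : Set V :=
  {z | G.graph.Reachable x z ∧ (G.graph.dist x z : ℝ) ≤ r}

theorem finite_ball (G : WeightedGraph V) (x : V) (r : ℝ) : (G.ball x r).Finite := by
  have key : ∀ k : ℕ, {z | ∃ p : G.graph.Walk x z, p.length = k}.Finite := by
    intro k
    induction k with
    | zero =>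
      refine (Set.finite_singleton x).subset ?_
      rintro z ⟨p, hp⟩
      exact (SimpleGraph.Walk.eq_of_length_eq_zero hp).symm
    | succ k ih =>
      refine (ih.biUnion (fun v _ => G.locallyFinite v)).subset ?_
      rintro z ⟨p, hp⟩
      rw [Set.mem_iUnion₂]
      have hnil : ¬ p.Nil := by
        intro h
        rw [← SimpleGraph.Walk.length_eq_zero_iff] at h
        omega
      exact ⟨p.penultimate, ⟨p.dropLast, by simp [hp]⟩, p.adj_penultimate hnil⟩
  refine (((Finset.range (⌊r⌋₊ + 1)).finite_toSet).biUnion (fun k _ => key k)).subset ?_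
  rintro z ⟨hz, hd⟩
  obtain ⟨p, hp⟩ := hz.exists_walk_length_eq_dist
  rw [Set.mem_iUnion₂]
  refine ⟨G.graph.dist x z, ?_, p, hp⟩
  simpa [Nat.lt_succ_iff] using Nat.le_floor hd

/-- The volume `vol(B(x, r)) = ∑_{z ∈ B(x, r)} μ z`. -/
noncomputable def volBall (G : WeightedGraph V) (x : V) (r : ℝ) : ℝ :=
  ∑ z ∈ (G.finite_ball x r).toFinset, G.μ z

theorem abs_laplacian_le (G : WeightedGraph V) {A M : ℝ} (hA : ∀ x, G.deg x ≤ A * G.μ x)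
    (f : V → ℝ) (hf : ∀ x, |f x| ≤ M) (x : V) : |G.laplacian f x| ≤ 2 * A * M := by
  have hM : 0 ≤ M := (abs_nonneg _).trans (hf x)
  have hμ := G.μ_pos x
  have h1 : |∑ y ∈ G.nbrs x, G.w x y * (f y - f x)| ≤ G.deg x * (2 * M) := by
    refine (Finset.abs_sum_le_sum_abs _ _).trans ?_
    rw [deg, Finset.sum_mul]
    refine Finset.sum_le_sum fun y hy => ?_
    have hadj : G.graph.Adj x y := by simpa [nbrs] using hy
    have hw := G.w_pos x y hadj
    rw [abs_mul, abs_of_pos hw]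
    refine mul_le_mul_of_nonneg_left ?_ hw.le
    have := abs_sub (f y) (f x)
    linarith [hf x, hf y]
  rw [laplacian, abs_mul, abs_of_pos (by positivity), one_div, inv_mul_le_iff₀ hμ]
  have := mul_le_mul_of_nonneg_right (hA x) (by positivity : 0 ≤ 2 * M)
  linarith

/-- If `deg / μ` is bounded, the series defining the heat kernel converges absolutely. -/
theorem summable_heatKernel (G : WeightedGraph V) {A : ℝ} (hA : ∀ x, G.deg x ≤ A * G.μ x)
    (t : ℝ) (x y : V) :
    Summable fun k : ℕ => |t ^ k / (k.factorial : ℝ) *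
      (G.laplacian)^[k] (Set.indicator {y} (fun _ => (1 : ℝ))) x| := by
  have hb : ∀ k : ℕ, ∀ z,
      |(G.laplacian)^[k] (Set.indicator {y} (fun _ => (1 : ℝ))) z| ≤ (2 * A) ^ k := by
    intro k
    induction k with
    | zero =>
      intro z
      by_cases hz : z = y <;> simp [hz]
    | succ k ih =>
      intro z
      rw [Function.iterate_succ_apply', pow_succ']
      exact G.abs_laplacian_le hA _ ih z
  refine Summable.of_nonneg_of_le (fun _ => abs_nonneg _) (fun k => ?_)
    (Real.summable_pow_div_factorial (|t| * (2 * A)))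
  rw [abs_mul, abs_div, abs_pow, Nat.abs_cast, mul_pow, mul_div_right_comm]
  exact mul_le_mul_of_nonneg_left (hb k x) (by positivity)

end WeightedGraph

/-!
The estimates follow from a parabolic Harnack inequality, which in turn follows from a Li–Yau
gradient estimate.

*Gradient estimate.* Let `u` be a solution of the heat equation with `0 < ε ≤ u ≤ M`, and put
`F = -2 t Δ√u / √u`. Since `u F / t = 2 Γ(√u) - Δu`, the heat operator `Δ - ∂ₜ` applied to this
function gives exactly four times the curvature expression of `CDE` at `√u`
(`four_mul_gam2_sub`), so `CDE` bounds it from below by `u F ^ 2 / (n t ^ 2)` wherever `F > 0`. At a maximum of `F` this gives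
`F ≤ n`. On an infinite graph no cutoff function is needed: `F ≤ 2 A t` holds for free
(`liYau_le`), so subtracting a small multiple of the distance to a base point makes the maximum
exist on a finite ball, and it costs only a small error in the maximum principle
(`liYau_sq_le_of_almost_max`, `liYau_le_dim`).

*Harnack inequality.* The gradient estimate says `∂ₜ u ≥ 2 Γ(√u) - n u / t`. Across an edge, the
gradient term dominates `(√u(x) - √u(y)) ^ 2`, and a Riccati comparison
(`log_sub_le_of_sqrt_sub_sq_le_deriv`) bounds `u(T₁, x) / u(T₂, y)`; running along a geodesic in
equal time steps gives the factor `exp (const * dist ^ 2 / (T₂ - T₁))`. Applying this to `u + ε`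
and letting `ε` tend to `0` covers nonnegative solutions (`harnack`).

*Heat kernel.* On bounded functions `e^{tΔ} = e^{-tA} e^{t(Δ + A)}` with `Δ + A` positive, which
gives positivity, `P_t(x, x) ≥ e^{-tA}` and `∑_z P_t(x, z) ≤ 1`. The lower bound compares
`P_1(y, y)` with `P_t(x, y)`. For the upper bound `P_t(x, y)` is compared with `P_{2t}(z, y)` for
`z ∈ B(x, √t)`, and the average over the ball is controlled by the symmetry
`μ(z) P(z, y) = μ(y) P(y, z)` and the total mass of the kernel.
-/

/-! ### Linearity of the Laplacian and the curvature expression -/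

namespace WeightedGraph

variable {V : Type*}

theorem mem_nbrs {G : WeightedGraph V} {x y : V} : y ∈ G.nbrs x ↔ G.graph.Adj x y := by
  simp [nbrs]

/-- The Laplacian as a linear endomorphism of the space of all functions. -/
noncomputable def laplacianHom (G : WeightedGraph V) : Module.End ℝ (V → ℝ) where
  toFun := G.laplacian
  map_add' f g := by
    funext x
    simp only [laplacian, Pi.add_apply]
    rw [← mul_add, ← Finset.sum_add_distrib]
    congr 1
    exact Finset.sum_congr rfl fun y _ => by ring
  map_smul' c f := by
    funext x
    simp only [laplacian, Pi.smul_apply, smul_eq_mul, RingHom.id_apply]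
    rw [mul_left_comm, Finset.mul_sum _ _ c]
    congr 1
    exact Finset.sum_congr rfl fun y _ => by ring

theorem laplacian_add (G : WeightedGraph V) (f g : V → ℝ) (x : V) :
    G.laplacian (fun z => f z + g z) x = G.laplacian f x + G.laplacian g x :=
  congrFun (G.laplacianHom.map_add f g) x

theorem laplacian_const_mul (G : WeightedGraph V) (c : ℝ) (f : V → ℝ) (x : V) :
    G.laplacian (fun z => c * f z) x = c * G.laplacian f x :=
  congrFun (G.laplacianHom.map_smul c f) x

theorem laplacian_sub (G : WeightedGraph V) (f g : V → ℝ) (x : V) :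
    G.laplacian (fun z => f z - g z) x = G.laplacian f x - G.laplacian g x :=
  congrFun (G.laplacianHom.map_sub f g) x

@[simp]
theorem laplacian_const (G : WeightedGraph V) (c : ℝ) (x : V) :
    G.laplacian (fun _ => c) x = 0 := by
  simp [laplacian]

theorem laplacian_eq_sub (G : WeightedGraph V) (f : V → ℝ) (x : V) :
    G.laplacian f x =
      (1 / G.μ x) * ∑ y ∈ G.nbrs x, G.w x y * f y - G.deg x / G.μ x * f x := by
  simp only [laplacian, deg, mul_sub, Finset.sum_sub_distrib, ← Finset.sum_mul]
  ring

theorem gam_eq_sum (G : WeightedGraph V) (f g : V → ℝ) (x : V) :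
    G.Gam f g x =
      (1 / (2 * G.μ x)) * ∑ y ∈ G.nbrs x, G.w x y * ((f y - f x) * (g y - g x)) := by
  have h : ∑ y ∈ G.nbrs x, G.w x y * ((f y - f x) * (g y - g x)) =
      ∑ y ∈ G.nbrs x, G.w x y * (f y * g y - f x * g x) -
        f x * ∑ y ∈ G.nbrs x, G.w x y * (g y - g x) -
        (∑ y ∈ G.nbrs x, G.w x y * (f y - f x)) * g x := by
    rw [Finset.mul_sum, Finset.sum_mul, ← Finset.sum_sub_distrib, ← Finset.sum_sub_distrib]
    exact Finset.sum_congr rfl fun y _ => by ring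
  rw [h, Gam, laplacian, laplacian, laplacian]
  have := (G.μ_pos x).ne'
  field_simp

/-- A single edge bounds the gradient form from below. -/
theorem edge_le_gam (G : WeightedGraph V) {c : ℝ} {x y : V} (hxy : G.graph.Adj x y)
    (hc : c * G.μ x ≤ G.w x y) (f : V → ℝ) : c * (f y - f x) ^ 2 ≤ 2 * G.Gam f f x := by
  have hμ := G.μ_pos x
  have h1 : G.w x y * ((f y - f x) * (f y - f x)) ≤
      ∑ z ∈ G.nbrs x, G.w x z * ((f z - f x) * (f z - f x)) :=
    Finset.single_le_sum (f := fun z => G.w x z * ((f z - f x) * (f z - f x)))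
      (fun z hz => mul_nonneg (G.w_pos x z (mem_nbrs.1 hz)).le (mul_self_nonneg _))
      (mem_nbrs.2 hxy)
  have h2 := mul_le_mul_of_nonneg_right hc (mul_self_nonneg (f y - f x))
  rw [gam_eq_sum]
  have h3 : 2 * (1 / (2 * G.μ x) *
      ∑ z ∈ G.nbrs x, G.w x z * ((f z - f x) * (f z - f x))) =
      (∑ z ∈ G.nbrs x, G.w x z * ((f z - f x) * (f z - f x))) / G.μ x := by
    field_simp
  rw [h3, le_div_iff₀ hμ]
  linarith

theorem gam_add_right (G : WeightedGraph V) (f g h : V → ℝ) (x : V) :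
    G.Gam f (fun z => g z + h z) x = G.Gam f g x + G.Gam f h x := by
  simp only [gam_eq_sum]
  rw [← mul_add, ← Finset.sum_add_distrib]
  congr 1
  exact Finset.sum_congr rfl fun y _ => by ring

theorem gam_comm (G : WeightedGraph V) (f g : V → ℝ) (x : V) : G.Gam f g x = G.Gam g f x := by
  simp only [gam_eq_sum, mul_comm]

theorem gam_self_nonneg (G : WeightedGraph V) (f : V → ℝ) (x : V) : 0 ≤ G.Gam f f x := by
  rw [gam_eq_sum]
  have hμ := G.μ_pos x
  exact mul_nonneg (by positivity) (Finset.sum_nonneg fun z hz =>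
    mul_nonneg (G.w_pos x z (mem_nbrs.1 hz)).le (mul_self_nonneg _))

theorem laplacian_mul_self (G : WeightedGraph V) (f : V → ℝ) (x : V) :
    G.laplacian (fun z => f z * f z) x = 2 * f x * G.laplacian f x + 2 * G.Gam f f x := by
  rw [Gam]
  ring

/-- If `f = √u` for a solution `u` of the heat equation, then `f' = Δ(f²) / (2 f)` is the time
derivative of `f`, and the curvature expression in `CDE` is a quarter of `(Δ - ∂ₜ)(-2 f Δ f)`. -/
theorem four_mul_gam2_sub (G : WeightedGraph V) (f f' : V → ℝ) (hf : ∀ z, 0 < f z)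
    (hf' : ∀ z, G.laplacian (fun z => f z * f z) z = 2 * f z * f' z) (x : V) :
    4 * (G.Gam2 f f x - G.Gam f (fun z => G.Gam f f z / f z) x) =
      G.laplacian (fun z => -2 * (f z * G.laplacian f z)) x +
        2 * (f' x * G.laplacian f x + f x * G.laplacian f' x) := by
  have hf'' : f' = fun z => G.laplacian f z + G.Gam f f z / f z := by
    funext z
    have h1 := hf' z
    rw [laplacian_mul_self] at h1
    have := (hf z).ne'
    field_simp
    linarith
  have h1 : G.Gam f f' x = G.Gam f (G.laplacian f) x +
      G.Gam f (fun z => G.Gam f f z / f z) x := by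
    conv_lhs => rw [hf'']
    exact G.gam_add_right _ _ _ _
  have h2 : G.Gam f f' x = (G.laplacian (fun z => f z * f' z) x - f x * G.laplacian f' x -
      G.laplacian f x * f' x) / 2 := rfl
  have h3 : G.Gam f f = fun z => f z * f' z - f z * G.laplacian f z := by
    funext z
    have := hf' z
    rw [laplacian_mul_self] at this
    linarith
  have h4 : G.laplacian (G.Gam f f) x =
      G.laplacian (fun z => f z * f' z) x - G.laplacian (fun z => f z * G.laplacian f z) x := by
    conv_lhs => rw [h3]
    exact G.laplacian_sub _ _ _
  rw [Gam2, G.gam_comm (G.laplacian f) f, h4, laplacian_const_mul]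
  linarith

/-- The Laplacian of a time-dependent function can be differentiated in time. -/
theorem hasDerivAt_laplacian (G : WeightedGraph V) {u : ℝ → V → ℝ} {u' : V → ℝ} {t : ℝ}
    (h : ∀ z, HasDerivAt (fun s => u s z) (u' z) t) (x : V) :
    HasDerivAt (fun s => G.laplacian (u s) x) (G.laplacian u' x) t := by
  simp only [laplacian]
  exact (HasDerivAt.fun_sum fun y _ => ((h y).sub (h x)).const_mul (G.w x y)).const_mul _

end WeightedGraph

open scoped Topology
/-! ### The Li–Yau gradient estimate -/

namespace WeightedGraph

variable {V : Type*}

/-- The Li–Yau quantity `F = -2 t Δ√u / √u` of a time-dependent function `u`. -/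
noncomputable def liYau (G : WeightedGraph V) (u : ℝ → V → ℝ) (t : ℝ) (x : V) : ℝ :=
  -2 * t * G.laplacian (fun z => √(u t z)) x / √(u t x)

theorem liYau_le (G : WeightedGraph V) {A : ℝ} (hA : ∀ x, G.deg x ≤ A * G.μ x)
    {u : ℝ → V → ℝ} {t : ℝ} (ht : 0 ≤ t) (hpos : ∀ z, 0 < u t z) (x : V) :
    G.liYau u t x ≤ 2 * A * t := by
  have hf : 0 < √(u t x) := Real.sqrt_pos.2 (hpos x)
  have hμ := G.μ_pos x
  have h1 : 0 ≤ (1 / G.μ x) * ∑ y ∈ G.nbrs x, G.w x y * √(u t y) :=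
    mul_nonneg (by positivity) (Finset.sum_nonneg fun y hy =>
      mul_nonneg (G.w_pos x y (mem_nbrs.1 hy)).le (Real.sqrt_nonneg _))
  have h2 : G.deg x / G.μ x ≤ A := (div_le_iff₀ hμ).2 (hA x)
  rw [liYau, div_le_iff₀ hf, laplacian_eq_sub]
  nlinarith [mul_le_mul_of_nonneg_right h2 (mul_nonneg ht hf.le), mul_nonneg ht h1]

/-- A function on `(0, t]` that is largest at `t` has a nonnegative derivative there. -/
theorem _root_.HasDerivAt.nonneg_of_le_left {g : ℝ → ℝ} {g' t : ℝ} (hg : HasDerivAt g g' t)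
    (ht : 0 < t) (hmax : ∀ s ∈ Set.Ioc 0 t, g s ≤ g t) : 0 ≤ g' := by
  have h := hg.tendsto_slope.mono_left
    (nhdsWithin_mono t (fun s (hs : s < t) => ne_of_lt hs) : 𝓝[<] t ≤ 𝓝[≠] t)
  refine ge_of_tendsto h ?_
  filter_upwards [Ioo_mem_nhdsLT ht] with s hs
  rw [slope_def_field]
  exact div_nonneg_of_nonpos (by linarith [hmax s ⟨hs.1, hs.2.le⟩]) (by linarith [hs.2])

/-- The maximum principle step. At a point where `F` is largest in time and, up to `η`, largest
among the neighbours, `(Δ - ∂ₜ)(u F) ≤ η A M`, while `CDE` bounds the same quantity from below by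
`(u / t) (F ^ 2 / n - F)`. -/
theorem liYau_sq_le_of_almost_max (G : WeightedGraph V) {n A M η t : ℝ} {x : V}
    (hCDE : G.CDEAt x n 0) (hA : G.deg x ≤ A * G.μ x) {u : ℝ → V → ℝ}
    (hu : ∀ z, HasDerivAt (fun s => u s z) (G.laplacian (u t) z) t)
    (hpos : ∀ z, 0 < u t z) (hM : ∀ z, u t z ≤ M) (hη : 0 ≤ η) (ht : 0 < t)
    (hspace : ∀ y ∈ G.nbrs x, G.liYau u t y ≤ G.liYau u t x + η)
    (htime : ∀ s ∈ Set.Ioc 0 t, G.liYau u s x ≤ G.liYau u t x)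
    (hF : 0 < G.liYau u t x) :
    u t x * (G.liYau u t x ^ 2 / n) ≤ u t x * G.liYau u t x + t * (η * (A * M)) := by
  set F := G.liYau u t x with hFdef
  set f : V → ℝ := fun z => √(u t z) with hf
  have hfpos : ∀ z, 0 < f z := fun z => Real.sqrt_pos.2 (hpos z)
  have hff : ∀ z, f z * f z = u t z := fun z => Real.mul_self_sqrt (hpos z).le
  have hff' : (fun z => f z * f z) = u t := funext hff
  set f' : V → ℝ := fun z => G.laplacian (u t) z / (2 * f z) with hf'
  have hf'eq : ∀ z, G.laplacian (u t) z = 2 * f z * f' z := fun z => by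
    have := (hfpos z).ne'
    simp only [hf']
    field_simp
  have hderiv : ∀ z, HasDerivAt (fun s => √(u s z)) (f' z) t := fun z =>
    (hu z).sqrt (hpos z).ne'
  have hlap : HasDerivAt (fun s => G.laplacian (fun z => √(u s z)) x) (G.laplacian f' x) t :=
    G.hasDerivAt_laplacian (u := fun s z => √(u s z)) hderiv x
  have hFd : HasDerivAt (fun s => G.liYau u s x)
      ((((-2 * 1) * G.laplacian f x + -2 * t * G.laplacian f' x) * f x -
        -2 * t * G.laplacian f x * f' x) / f x ^ 2) t :=
    ((((hasDerivAt_id t).const_mul (-2)).mul hlap).div (hderiv x) (hfpos x).ne')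
  have hx := hfpos x
  have hFeq : F * f x = -2 * t * G.laplacian f x := by
    rw [hFdef, liYau]
    exact div_mul_cancel₀ _ hx.ne'
  have hneg : G.laplacian f x < 0 := by
    have : 0 < F * f x := mul_pos hF hx
    by_contra! hcon
    have := mul_nonneg ht.le hcon
    linarith
  -- Maximality in time.
  have h1 := hFd.nonneg_of_le_left ht htime
  rw [le_div_iff₀ (by positivity), zero_mul] at h1
  -- Maximality in space.
  have hμ := G.μ_pos x
  have h2 : t * G.laplacian (fun z => -2 * (f z * G.laplacian f z)) x ≤
      F * G.laplacian (u t) x + η * (A * M) := by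
    have hH : ∀ z, t * (-2 * (f z * G.laplacian f z)) = u t z * G.liYau u t z := by
      intro z
      have : G.liYau u t z * f z = -2 * t * G.laplacian f z := by
        rw [liYau]
        exact div_mul_cancel₀ _ (hfpos z).ne'
      rw [← hff z]
      linear_combination (-f z) * this
    rw [← laplacian_const_mul]
    simp only [hH]
    have h3 : G.laplacian (fun z => u t z * G.liYau u t z) x ≤
        F * G.laplacian (u t) x + η * ((1 / G.μ x) * ∑ y ∈ G.nbrs x, G.w x y * u t y) := by
      rw [laplacian, laplacian, mul_left_comm F, mul_left_comm η, ← mul_add, Finset.mul_sum _ _ F,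
        Finset.mul_sum _ _ η, ← Finset.sum_add_distrib]
      refine mul_le_mul_of_nonneg_left (Finset.sum_le_sum fun y hy => ?_) (by positivity)
      have hw := (G.w_pos x y (mem_nbrs.1 hy)).le
      have := mul_le_mul_of_nonneg_left (hspace y hy) (mul_nonneg hw (hpos y).le)
      linarith
    have h4 : (1 / G.μ x) * ∑ y ∈ G.nbrs x, G.w x y * u t y ≤ A * M := by
      have hM0 : 0 ≤ M := (hpos x).le.trans (hM x)
      rw [one_div, inv_mul_le_iff₀ hμ]
      calc ∑ y ∈ G.nbrs x, G.w x y * u t y ≤ ∑ y ∈ G.nbrs x, G.w x y * M :=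
            Finset.sum_le_sum fun y hy =>
              mul_le_mul_of_nonneg_left (hM y) (G.w_pos x y (mem_nbrs.1 hy)).le
        _ = G.deg x * M := by rw [deg, Finset.sum_mul]
        _ ≤ (A * G.μ x) * M := mul_le_mul_of_nonneg_right hA hM0
        _ = G.μ x * (A * M) := by ring
    linarith [mul_le_mul_of_nonneg_left h4 hη]
  have h5 := hCDE f hfpos hneg
  have h6 := G.four_mul_gam2_sub f f' hfpos (by rw [hff']; exact hf'eq) x
  rw [hf'eq x] at h2
  have h7 : t * (4 * ((1 / n) * G.laplacian f x ^ 2)) ≤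
      -2 * (f x * G.laplacian f x) + η * (A * M) := by
    have e1 : F * (2 * f x * f' x) = -4 * t * G.laplacian f x * f' x := by
      linear_combination 2 * f' x * hFeq
    have := mul_le_mul_of_nonneg_left h5 ht.le
    nlinarith
  have h8 := mul_le_mul_of_nonneg_left h7 ht.le
  have e2 : t * (t * (4 * ((1 / n) * G.laplacian f x ^ 2))) = u t x * (F ^ 2 / n) := by
    rw [← hff x]
    linear_combination (-(1 / n)) * (F * f x + -2 * t * G.laplacian f x) * hFeq
  have e3 : t * (-2 * (f x * G.laplacian f x)) = u t x * F := by
    rw [← hff x]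
    linear_combination (-f x) * hFeq
  linarith

end WeightedGraph

namespace WeightedGraph

variable {V : Type*}

theorem continuousOn_liYau (G : WeightedGraph V) {u : ℝ → V → ℝ} {s : Set ℝ}
    (hu : ∀ z, Continuous fun t => u t z) (hpos : ∀ t ∈ s, ∀ z, 0 < u t z) (x : V) :
    ContinuousOn (fun t => G.liYau u t x) s := by
  have h : ∀ z, Continuous fun t => √(u t z) := fun z => (hu z).sqrt
  refine ContinuousOn.div ?_ (h x).continuousOn fun t ht => (Real.sqrt_pos.2 (hpos t ht x)).ne'
  refine Continuous.continuousOn ((continuous_const.mul continuous_id).mul ?_)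
  exact continuous_const.mul (continuous_finsetSum _ fun y _ =>
    continuous_const.mul ((h y).sub (h x)))

theorem dist_le_dist_add_one {H : SimpleGraph V} {a x y : V} (h : H.Reachable a x)
    (hxy : H.Adj x y) : H.dist a y ≤ H.dist a x + 1 := by
  obtain ⟨p, hp⟩ := h.exists_walk_length_eq_dist
  have := SimpleGraph.dist_le (p.concat hxy)
  rwa [SimpleGraph.Walk.length_concat, hp] at this

/-- The Li–Yau estimate `-Δ√u / √u ≤ n / (2 t)` for solutions of the heat equation that are
bounded above and bounded away from zero. -/
theorem liYau_le_dim (G : WeightedGraph V) {n A ε M : ℝ} (hn : 0 < n) (hA0 : 0 < A)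
    (hCDE : G.CDE n 0) (hA : ∀ x, G.deg x ≤ A * G.μ x) {u : ℝ → V → ℝ}
    (hu : ∀ t z, HasDerivAt (fun s => u s z) (G.laplacian (u t) z) t) (hε : 0 < ε)
    (hlow : ∀ t, 0 ≤ t → ∀ z, ε ≤ u t z) (hM : ∀ t, 0 ≤ t → ∀ z, u t z ≤ M)
    {T : ℝ} (hT : 0 < T) (x₀ : V) : G.liYau u T x₀ ≤ n := by
  by_contra! hcon
  set F₀ := G.liYau u T x₀ with hF₀
  have hF₀pos : 0 < F₀ := hn.trans hcon
  have hM0 : 0 < M := hε.trans_le ((hlow T hT.le x₀).trans (hM T hT.le x₀))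
  have hgap : 0 < F₀ * (F₀ - n) := mul_pos hF₀pos (sub_pos.2 hcon)
  -- The penalty `δ * dist x₀ ·` forces the supremum of `F` to be attained; it changes `F` by at
  -- most `δ` along an edge.
  set δ := ε * (F₀ * (F₀ - n)) / (2 * (n * (T * (A * M)))) with hδ
  have hδpos : 0 < δ := by positivity
  have hδeq : δ * (2 * (n * (T * (A * M)))) = ε * (F₀ * (F₀ - n)) :=
    div_mul_cancel₀ _ (by positivity)
  have hpos : ∀ t, 0 ≤ t → ∀ z, 0 < u t z := fun t ht z => hε.trans_le (hlow t ht z)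
  have hcont : ∀ y, ContinuousOn (fun t => G.liYau u t y) (Set.Icc 0 T) := fun y =>
    G.continuousOn_liYau
      (fun z => continuous_iff_continuousAt.2 fun t => (hu t z).continuousAt)
      (fun t ht => hpos t ht.1) y
  have hex : ∀ y, ∃ s ∈ Set.Icc 0 T, ∀ r ∈ Set.Icc 0 T, G.liYau u r y ≤ G.liYau u s y :=
    fun y => isCompact_Icc.exists_isMaxOn ⟨0, le_rfl, hT.le⟩ (hcont y)
  choose τ hτmem hτmax using hex
  set S := (G.finite_ball x₀ (2 * A * T / δ)).toFinset with hS
  have hx₀S : x₀ ∈ S := by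
    rw [hS, Set.Finite.mem_toFinset]
    refine ⟨SimpleGraph.Reachable.refl _, ?_⟩
    rw [SimpleGraph.dist_self, Nat.cast_zero]
    positivity
  obtain ⟨x, hxS, hx⟩ := S.exists_max_image
    (fun y => G.liYau u (τ y) y - δ * (G.graph.dist x₀ y : ℝ)) ⟨x₀, hx₀S⟩
  have hreach : G.graph.Reachable x₀ x := by
    rw [hS, Set.Finite.mem_toFinset] at hxS
    exact hxS.1
  have hstart : F₀ ≤ G.liYau u (τ x) x - δ * (G.graph.dist x₀ x : ℝ) := by
    have h1 := hx x₀ hx₀S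
    have h2 := hτmax x₀ T ⟨hT.le, le_rfl⟩
    simp only [SimpleGraph.dist_self, Nat.cast_zero, mul_zero, sub_zero] at h1
    linarith
  have hglobal : ∀ y, G.graph.Reachable x₀ y → ∀ s ∈ Set.Icc 0 T,
      G.liYau u s y - δ * (G.graph.dist x₀ y : ℝ) ≤
        G.liYau u (τ x) x - δ * (G.graph.dist x₀ x : ℝ) := by
    intro y hy s hs
    by_cases hyS : y ∈ S
    · linarith [hx y hyS, hτmax y s hs]
    · have hd : 2 * A * T / δ < (G.graph.dist x₀ y : ℝ) := by
        by_contra! hle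
        exact hyS (by rw [hS, Set.Finite.mem_toFinset]; exact ⟨hy, hle⟩)
      rw [div_lt_iff₀ hδpos] at hd
      have h1 := G.liYau_le hA hs.1 (hpos s hs.1) y
      have h2 : 2 * A * s ≤ 2 * A * T := mul_le_mul_of_nonneg_left hs.2 (by positivity)
      linarith
  have hF₀le : F₀ ≤ G.liYau u (τ x) x := by
    have : 0 ≤ δ * (G.graph.dist x₀ x : ℝ) := by positivity
    linarith
  have hτpos : 0 < τ x := by
    refine lt_of_le_of_ne (hτmem x).1 fun h0 => ?_
    rw [← h0] at hF₀le
    simp only [liYau, mul_zero, zero_mul, zero_div] at hF₀le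
    linarith
  have key := G.liYau_sq_le_of_almost_max (η := δ) (hCDE x) (hA x) (hu (τ x))
    (hpos _ hτpos.le) (hM _ hτpos.le) hδpos.le hτpos
    (fun y hy => by
      have hadj := mem_nbrs.1 hy
      have h1 := hglobal y (hreach.trans hadj.reachable) (τ x) (hτmem x)
      have h2 : (G.graph.dist x₀ y : ℝ) ≤ G.graph.dist x₀ x + 1 := by
        exact_mod_cast dist_le_dist_add_one hreach hadj
      have h3 := mul_le_mul_of_nonneg_left h2 hδpos.le
      linarith)
    (fun s hs => hτmax x s ⟨hs.1.le, hs.2.trans (hτmem x).2⟩)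
    (hF₀pos.trans_le hF₀le)
  set F := G.liYau u (τ x) x
  have h1 : u (τ x) x * (F * (F - n)) ≤ n * (τ x * (δ * (A * M))) := by
    have h := mul_le_mul_of_nonneg_left key hn.le
    have e : n * (u (τ x) x * (F ^ 2 / n)) = u (τ x) x * F ^ 2 := by field_simp
    rw [e] at h
    linarith
  have h2 : F₀ * (F₀ - n) ≤ F * (F - n) :=
    mul_le_mul hF₀le (by linarith) (by linarith) (by linarith)
  have h3 : ε * (F₀ * (F₀ - n)) ≤ u (τ x) x * (F * (F - n)) :=
    mul_le_mul (hlow _ hτpos.le x) h2 hgap.le (hpos _ hτpos.le x).le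
  have h4 : n * (τ x * (δ * (A * M))) ≤ n * (T * (δ * (A * M))) := by
    have := (hτmem x).2
    gcongr
  have h5 : 0 < ε * (F₀ * (F₀ - n)) := mul_pos hε hgap
  linarith

/-- The differential form of the Li–Yau estimate, `∂ₜ u ≥ 2 Γ(√u) - n u / t`. -/
theorem gam_sqrt_sub_le_laplacian (G : WeightedGraph V) {n A ε M : ℝ} (hn : 0 < n) (hA0 : 0 < A)
    (hCDE : G.CDE n 0) (hA : ∀ x, G.deg x ≤ A * G.μ x) {u : ℝ → V → ℝ}
    (hu : ∀ t z, HasDerivAt (fun s => u s z) (G.laplacian (u t) z) t) (hε : 0 < ε)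
    (hlow : ∀ t, 0 ≤ t → ∀ z, ε ≤ u t z) (hM : ∀ t, 0 ≤ t → ∀ z, u t z ≤ M)
    {t : ℝ} (ht : 0 < t) (x : V) :
    2 * G.Gam (fun z => √(u t z)) (fun z => √(u t z)) x - n * u t x / t ≤
      G.laplacian (u t) x := by
  have h := G.liYau_le_dim hn hA0 hCDE hA hu hε hlow hM ht x
  have hpos : ∀ z, 0 < u t z := fun z => hε.trans_le (hlow t ht.le z)
  have hx : 0 < √(u t x) := Real.sqrt_pos.2 (hpos x)
  have hsq := Real.mul_self_sqrt (hpos x).le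
  rw [liYau, div_le_iff₀ hx] at h
  have e := G.laplacian_mul_self (fun z => √(u t z)) x
  simp only [Real.mul_self_sqrt (hpos _).le] at e
  change G.laplacian (u t) x = _ at e
  rw [e, sub_le_iff_le_add, ← sub_le_iff_le_add', le_div_iff₀ ht]
  have := mul_le_mul_of_nonneg_right h hx.le
  nlinarith

end WeightedGraph

/-! ### The Harnack inequality -/

theorem le_of_hasDerivAt_nonneg {g g' : ℝ → ℝ} {a b : ℝ} (hab : a ≤ b)
    (hg : ∀ s ∈ Set.Icc a b, HasDerivAt g (g' s) s) (hg' : ∀ s ∈ Set.Icc a b, 0 ≤ g' s) :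
    g a ≤ g b :=
  monotoneOn_of_hasDerivWithinAt_nonneg (convex_Icc a b)
    (fun s hs => (hg s hs).continuousAt.continuousWithinAt)
    (fun s hs => (hg s (interior_subset hs)).hasDerivWithinAt)
    (fun s hs => hg' s (interior_subset hs))
    (Set.left_mem_Icc.2 hab) (Set.right_mem_Icc.2 hab) hab

/-- `t ^ n a t` does not decrease if `a' ≥ -n a / t`. -/
theorem log_add_le_of_neg_div_le_deriv {n T₁ T₂ : ℝ} (hT₁ : 0 < T₁) (hT : T₁ ≤ T₂)
    {a a' : ℝ → ℝ} (ha : ∀ s ∈ Set.Icc T₁ T₂, HasDerivAt a (a' s) s)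
    (hapos : ∀ s ∈ Set.Icc T₁ T₂, 0 < a s)
    (hn : ∀ s ∈ Set.Icc T₁ T₂, -(n * a s / s) ≤ a' s) :
    Real.log (a T₁) + n * Real.log T₁ ≤ Real.log (a T₂) + n * Real.log T₂ := by
  refine le_of_hasDerivAt_nonneg (g := fun s => Real.log (a s) + n * Real.log s)
    (g' := fun s => a' s / a s + n * s⁻¹) hT (fun s hs => ?_) (fun s hs => ?_)
  · exact ((ha s hs).log (hapos s hs).ne').add
      ((Real.hasDerivAt_log (hT₁.trans_le hs.1).ne').const_mul n)
  · have h1 := hn s hs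
    have h2 := hapos s hs
    have h3 : 0 < s := hT₁.trans_le hs.1
    have h4 : a' s / a s + n * s⁻¹ = (a' s + n * a s / s) / a s := by field_simp
    rw [h4]
    exact div_nonneg (by linarith) h2.le

/-- The Harnack inequality across one edge: `a` and `b` are the values of a positive solution at
its two ends. If it failed, then `J s = log (T₁ ^ n a T₁) - log (s ^ n b s)` would satisfy the
Riccati inequality `J' ≤ -c J ^ 2 / 4`, and `1 / J` would grow by more than it can. -/
theorem log_sub_le_of_sqrt_sub_sq_le_deriv {n c T₁ T₂ : ℝ} (hc : 0 < c) (hT₁ : 0 < T₁)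
    (hT : T₁ < T₂) {a b a' b' : ℝ → ℝ}
    (ha : ∀ s ∈ Set.Icc T₁ T₂, HasDerivAt a (a' s) s)
    (hb : ∀ s ∈ Set.Icc T₁ T₂, HasDerivAt b (b' s) s)
    (hapos : ∀ s ∈ Set.Icc T₁ T₂, 0 < a s) (hbpos : ∀ s ∈ Set.Icc T₁ T₂, 0 < b s)
    (hna : ∀ s ∈ Set.Icc T₁ T₂, -(n * a s / s) ≤ a' s)
    (hnb : ∀ s ∈ Set.Icc T₁ T₂, c * (√(a s) - √(b s)) ^ 2 - n * b s / s ≤ b' s) :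
    Real.log (a T₁) + n * Real.log T₁ - (Real.log (b T₂) + n * Real.log T₂) ≤
      4 / (c * (T₂ - T₁)) := by
  by_contra! hcon
  have hL : 0 < c * (T₂ - T₁) := mul_pos hc (sub_pos.2 hT)
  set J : ℝ → ℝ := fun s =>
    Real.log (a T₁) + n * Real.log T₁ - (Real.log (b s) + n * Real.log s) with hJ
  set J' : ℝ → ℝ := fun s => -(b' s / b s + n * s⁻¹) with hJ'
  have hJd : ∀ s ∈ Set.Icc T₁ T₂, HasDerivAt J (J' s) s := fun s hs =>
    ((((hb s hs).log (hbpos s hs).ne').add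
      ((Real.hasDerivAt_log (hT₁.trans_le hs.1).ne').const_mul n)).const_sub _)
  have hJpos : ∀ s ∈ Set.Icc T₁ T₂, 0 < J s := by
    intro s hs
    have h := log_add_le_of_neg_div_le_deriv (n := n) (a := b) (a' := b') (hT₁.trans_le hs.1) hs.2
      (fun r hr => hb r ⟨hs.1.trans hr.1, hr.2⟩) (fun r hr => hbpos r ⟨hs.1.trans hr.1, hr.2⟩)
      (fun r hr => by
        have h1 := hnb r ⟨hs.1.trans hr.1, hr.2⟩
        have h2 := mul_nonneg hc.le (sq_nonneg (√(a r) - √(b r)))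
        linarith)
    have : 0 < 4 / (c * (T₂ - T₁)) := by positivity
    simp only [hJ]
    linarith
  have hJric : ∀ s ∈ Set.Icc T₁ T₂, J' s ≤ -(c / 4 * J s ^ 2) := by
    intro s hs
    have has := hapos s hs
    have hbs := hbpos s hs
    have hs0 : 0 < s := hT₁.trans_le hs.1
    have hα := Real.sqrt_pos.2 has
    have hβ := Real.sqrt_pos.2 hbs
    have hlog : J s ≤ 2 * (√(a s) / √(b s) - 1) := by
      have h1 := log_add_le_of_neg_div_le_deriv (n := n) (a := a) (a' := a') hT₁ hs.1
        (fun r hr => ha r ⟨hr.1, hr.2.trans hs.2⟩) (fun r hr => hapos r ⟨hr.1, hr.2.trans hs.2⟩)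
        (fun r hr => hna r ⟨hr.1, hr.2.trans hs.2⟩)
      have h2 := Real.log_le_sub_one_of_pos (div_pos hα hβ)
      rw [Real.log_div hα.ne' hβ.ne', Real.log_sqrt has.le, Real.log_sqrt hbs.le] at h2
      simp only [hJ]
      linarith
    have hsq : J s ^ 2 ≤ 4 * (√(a s) / √(b s) - 1) ^ 2 := by
      nlinarith [hJpos s hs]
    have hb' : c * (√(a s) / √(b s) - 1) ^ 2 ≤ b' s / b s + n * s⁻¹ := by
      have h4 : b' s / b s + n * s⁻¹ = (b' s + n * b s / s) / b s := by field_simp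
      rw [h4, le_div_iff₀ hbs]
      have h5 : c * (√(a s) / √(b s) - 1) ^ 2 * b s = c * (√(a s) - √(b s)) ^ 2 := by
        conv_lhs => rw [← Real.sq_sqrt hbs.le]
        rw [Real.sqrt_sq hβ.le, mul_assoc, ← mul_pow, sub_mul, div_mul_cancel₀ _ hβ.ne', one_mul]
      rw [h5]
      linarith [hnb s hs]
    have := mul_le_mul_of_nonneg_left hsq hc.le
    simp only [hJ']
    linarith
  have hmono := le_of_hasDerivAt_nonneg (g := fun s => (J s)⁻¹ - c / 4 * s)
    (g' := fun s => -J' s / J s ^ 2 - c / 4 * 1) hT.le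
    (fun s hs => ((hJd s hs).inv (hJpos s hs).ne').sub ((hasDerivAt_id s).const_mul (c / 4)))
    (fun s hs => by
      have h1 := hJpos s hs
      rw [sub_nonneg, mul_one, le_div_iff₀ (by positivity)]
      linarith [hJric s hs])
  have h1 := inv_pos.2 (hJpos T₁ (Set.left_mem_Icc.2 hT.le))
  have h2 : (J T₂)⁻¹ < (4 / (c * (T₂ - T₁)))⁻¹ := inv_strictAnti₀ (by positivity) hcon
  rw [inv_div] at h2
  linarith

/-! ### The heat semigroup on bounded functions -/

open scoped ENNReal

/-- The exponential series of a bounded operator, applied to a vector and tested against a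
functional. -/
theorem hasSum_exp_smul_apply {E : Type*} [NormedAddCommGroup E] [NormedSpace ℝ E]
    [CompleteSpace E] (L : E →L[ℝ] E) (ℓ : E →L[ℝ] ℝ) (t : ℝ) (f : E) :
    HasSum (fun k : ℕ => t ^ k / (k.factorial : ℝ) * ℓ ((L ^ k) f))
      (ℓ (NormedSpace.exp (t • L) f)) := by
  have h := (NormedSpace.exp_series_hasSum_exp' (𝕂 := ℝ) (t • L)).mapL
    (ℓ.comp (ContinuousLinearMap.apply ℝ E f))
  refine h.congr_fun fun k => ?_
  rw [smul_pow, smul_smul]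
  simp [div_eq_inv_mul]

theorem hasDerivAt_exp_smul_apply {E : Type*} [NormedAddCommGroup E] [NormedSpace ℝ E]
    [CompleteSpace E] (L : E →L[ℝ] E) (ℓ : E →L[ℝ] ℝ) (t : ℝ) (f : E) :
    HasDerivAt (fun s : ℝ => ℓ (NormedSpace.exp (s • L) f))
      (ℓ (L (NormedSpace.exp (t • L) f))) t :=
  (ℓ.comp (ContinuousLinearMap.apply ℝ E f)).hasFDerivAt.comp_hasDerivAt t
    (hasDerivAt_exp_smul_const' (𝕂 := ℝ) L t)

theorem exp_smul_eq_smul_exp_smul_add {𝔸 : Type*} [NormedRing 𝔸] [NormedAlgebra ℝ 𝔸]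
    [CompleteSpace 𝔸] (a : 𝔸) (c t : ℝ) :
    NormedSpace.exp (t • a) =
      Real.exp (-(t * c)) • NormedSpace.exp (t • (a + algebraMap ℝ 𝔸 c)) := by
  let _ : NormedAlgebra ℚ 𝔸 := NormedAlgebra.restrictScalars ℚ ℝ 𝔸
  have e1 : t • a = algebraMap ℝ 𝔸 (-(t * c)) + t • (a + algebraMap ℝ 𝔸 c) := by
    rw [smul_add, map_neg, map_mul, ← Algebra.smul_def]
    abel
  conv_lhs => rw [e1]
  rw [NormedSpace.exp_add_of_commute (Algebra.commutes _ _), ← NormedSpace.algebraMap_exp_comm,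
    ← Algebra.smul_def, Real.exp_eq_exp_ℝ]

namespace WeightedGraph

variable {V : Type*}

/-- The Laplacian as a bounded operator on the bounded functions, when `deg ≤ A μ`. -/
noncomputable def laplacianCLM (G : WeightedGraph V) {A : ℝ} (hA0 : 0 ≤ A)
    (hA : ∀ x, G.deg x ≤ A * G.μ x) :
    lp (fun _ : V => ℝ) ∞ →L[ℝ] lp (fun _ : V => ℝ) ∞ :=
  LinearMap.mkContinuous
    { toFun := fun f => ⟨G.laplacian f, memℓp_infty ⟨2 * A * ‖f‖, by
        rintro _ ⟨x, rfl⟩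
        exact G.abs_laplacian_le hA f (lp.norm_apply_le_norm ENNReal.top_ne_zero f) x⟩⟩
      map_add' := fun f g => Subtype.ext (G.laplacianHom.map_add f g)
      map_smul' := fun c f => Subtype.ext (G.laplacianHom.map_smul c f) }
    (2 * A) fun f => lp.norm_le_of_forall_le (by positivity)
      (G.abs_laplacian_le hA f (lp.norm_apply_le_norm ENNReal.top_ne_zero f))

variable (G : WeightedGraph V) {A : ℝ} (hA0 : 0 ≤ A) (hA : ∀ x, G.deg x ≤ A * G.μ x)

theorem laplacianCLM_pow_apply (k : ℕ) (f : lp (fun _ : V => ℝ) ∞) :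
    ((G.laplacianCLM hA0 hA ^ k) f : V → ℝ) = G.laplacian^[k] f := by
  induction k with
  | zero => rfl
  | succ k ih =>
    rw [pow_succ', Function.iterate_succ_apply', ← ih]
    rfl

/-- Evaluation of a bounded function at a point. -/
noncomputable def evalCLM (x : V) : lp (fun _ : V => ℝ) ∞ →L[ℝ] ℝ :=
  LinearMap.mkContinuous
    { toFun := fun f => f x
      map_add' := fun _ _ => rfl
      map_smul' := fun _ _ => rfl }
    1 fun f => by
      rw [one_mul]
      exact lp.norm_apply_le_norm ENNReal.top_ne_zero f x

/-- The heat semigroup `e^{tΔ}` on bounded functions. -/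
noncomputable def heat (t : ℝ) : lp (fun _ : V => ℝ) ∞ →L[ℝ] lp (fun _ : V => ℝ) ∞ :=
  NormedSpace.exp (t • G.laplacianCLM hA0 hA)

theorem hasSum_heat (t : ℝ) (f : lp (fun _ : V => ℝ) ∞) (x : V) :
    HasSum (fun k : ℕ => t ^ k / (k.factorial : ℝ) * G.laplacian^[k] f x)
      (G.heat hA0 hA t f x) := by
  refine (hasSum_exp_smul_apply (G.laplacianCLM hA0 hA) (evalCLM x) t f).congr_fun fun k => ?_
  rw [← G.laplacianCLM_pow_apply hA0 hA]
  rfl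

theorem hasDerivAt_heat (f : lp (fun _ : V => ℝ) ∞) (t : ℝ) (x : V) :
    HasDerivAt (fun s => G.heat hA0 hA s f x) (G.laplacian (G.heat hA0 hA t f) x) t :=
  hasDerivAt_exp_smul_apply (G.laplacianCLM hA0 hA) (evalCLM x) t f

/-- `Δ + A` preserves positivity, and `e^{tΔ} = e^{-tA} e^{t(Δ + A)}`; keeping only the first term
of the series of the last factor gives a lower bound. -/
theorem exp_mul_le_heat {t : ℝ} (ht : 0 ≤ t) {f : lp (fun _ : V => ℝ) ∞} (hf : ∀ x, 0 ≤ f x)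
    (x : V) : Real.exp (-(t * A)) * f x ≤ G.heat hA0 hA t f x := by
  set L := G.laplacianCLM hA0 hA with hL
  set B := L + algebraMap ℝ (lp (fun _ : V => ℝ) ∞ →L[ℝ] lp (fun _ : V => ℝ) ∞) A with hB
  have hBpos : ∀ g : lp (fun _ : V => ℝ) ∞, (∀ x, 0 ≤ g x) → ∀ x, 0 ≤ B g x := by
    intro g hg x
    have e : B g x = G.laplacian g x + A * g x := rfl
    have hμ := G.μ_pos x
    have h1 : 0 ≤ (1 / G.μ x) * ∑ y ∈ G.nbrs x, G.w x y * g y :=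
      mul_nonneg (by positivity) (Finset.sum_nonneg fun y hy =>
        mul_nonneg (G.w_pos x y (mem_nbrs.1 hy)).le (hg y))
    have h2 := mul_le_mul_of_nonneg_right ((div_le_iff₀ hμ).2 (hA x)) (hg x)
    rw [e, laplacian_eq_sub]
    linarith
  have hBpow : ∀ k : ℕ, ∀ x, 0 ≤ (B ^ k) f x := by
    intro k
    induction k with
    | zero => exact hf
    | succ k ih =>
      intro x
      rw [pow_succ']
      exact hBpos _ ih x
  have hsum := hasSum_exp_smul_apply B (evalCLM x) t f
  have h0 := le_hasSum hsum 0 fun k _ => mul_nonneg (by positivity) (hBpow k x)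
  have h0' : f x ≤ NormedSpace.exp (t • B) f x := by
    rw [pow_zero, pow_zero, Nat.factorial_zero, Nat.cast_one, div_one, one_mul] at h0
    exact h0
  have e2 : G.heat hA0 hA t f x = Real.exp (-(t * A)) * NormedSpace.exp (t • B) f x :=
    congrArg (fun T : lp (fun _ : V => ℝ) ∞ →L[ℝ] lp (fun _ : V => ℝ) ∞ => evalCLM x (T f))
      (exp_smul_eq_smul_exp_smul_add L A t)
  rw [e2]
  exact mul_le_mul_of_nonneg_left h0' (Real.exp_pos _).le

theorem heat_nonneg {t : ℝ} (ht : 0 ≤ t) {f : lp (fun _ : V => ℝ) ∞} (hf : ∀ x, 0 ≤ f x)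
    (x : V) : 0 ≤ G.heat hA0 hA t f x :=
  (mul_nonneg (Real.exp_pos _).le (hf x)).trans (G.exp_mul_le_heat hA0 hA ht hf x)

/-- The indicator function of a point as a bounded function. -/
noncomputable def delta (y : V) : lp (fun _ : V => ℝ) ∞ :=
  ⟨Set.indicator {y} fun _ => 1, memℓp_infty ⟨1, by
    rintro _ ⟨x, rfl⟩
    by_cases hx : x = y <;> simp [hx]⟩⟩

theorem delta_apply [DecidableEq V] (x y : V) : delta y x = if x = y then 1 else 0 := by
  change Set.indicator {y} (fun _ => (1 : ℝ)) x = _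
  by_cases hx : x = y <;> simp [hx]

theorem heatKernel_eq_heat (t : ℝ) (x y : V) :
    G.heatKernel t x y = G.heat hA0 hA t (delta y) x :=
  (G.hasSum_heat hA0 hA t (delta y) x).tsum_eq

theorem heat_one (t : ℝ) (x : V) : G.heat hA0 hA t 1 x = 1 := by
  have h := G.hasSum_heat hA0 hA t 1 x
  have hz : ∀ k : ℕ, k ≠ 0 → t ^ k / (k.factorial : ℝ) *
      G.laplacian^[k] (1 : lp (fun _ : V => ℝ) ∞) x = 0 := by
    intro k hk
    obtain ⟨k, rfl⟩ := Nat.exists_eq_succ_of_ne_zero hk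
    have h1 : G.laplacian (1 : lp (fun _ : V => ℝ) ∞) = 0 :=
      funext fun z => G.laplacian_const 1 z
    have h2 : G.laplacian^[k] 0 = 0 :=
      Function.iterate_fixed (G.laplacianHom.map_zero) k
    rw [Function.iterate_succ_apply, h1, h2]
    simp
  rw [h.unique (hasSum_single 0 hz)]
  simp

theorem hasDerivAt_heatKernel (hA : ∀ x, G.deg x ≤ A * G.μ x) (hA0 : 0 ≤ A) (t : ℝ) (x y : V) :
    HasDerivAt (fun s => G.heatKernel s x y)
      (G.laplacian (fun z => G.heatKernel t z y) x) t := by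
  simp only [G.heatKernel_eq_heat hA0 hA]
  exact G.hasDerivAt_heat hA0 hA (delta y) t x

theorem heatKernel_nonneg (hA : ∀ x, G.deg x ≤ A * G.μ x) (hA0 : 0 ≤ A) {t : ℝ} (ht : 0 ≤ t)
    (x y : V) : 0 ≤ G.heatKernel t x y := by
  classical
  rw [G.heatKernel_eq_heat hA0 hA]
  refine G.heat_nonneg hA0 hA ht (fun z => ?_) x
  rw [delta_apply]
  split_ifs <;> norm_num

theorem exp_le_heatKernel_self (hA : ∀ x, G.deg x ≤ A * G.μ x) (hA0 : 0 ≤ A) {t : ℝ}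
    (ht : 0 ≤ t) (x : V) : Real.exp (-(t * A)) ≤ G.heatKernel t x x := by
  classical
  rw [G.heatKernel_eq_heat hA0 hA]
  have h := G.exp_mul_le_heat hA0 hA ht (f := delta x) (fun z => by
    rw [delta_apply]
    split_ifs <;> norm_num) x
  simpa [delta_apply] using h

theorem sum_heatKernel_le_one (hA : ∀ x, G.deg x ≤ A * G.μ x) (hA0 : 0 ≤ A) {t : ℝ}
    (ht : 0 ≤ t) (x : V) (S : Finset V) : ∑ z ∈ S, G.heatKernel t x z ≤ 1 := by
  classical
  have hcoe : ∀ z, (1 - ∑ y ∈ S, delta y : lp (fun _ : V => ℝ) ∞) z =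
      1 - ∑ y ∈ S, delta y z := by
    intro z
    have h := map_sub (evalCLM z) 1 (∑ y ∈ S, delta y)
    rw [map_sum] at h
    exact h
  have h := G.heat_nonneg hA0 hA ht (f := 1 - ∑ y ∈ S, delta y) (fun z => by
    rw [hcoe]
    simp only [delta_apply, Finset.sum_ite_eq]
    split_ifs <;> norm_num) x
  have e := map_sub ((evalCLM x).comp (G.heat hA0 hA t)) 1 (∑ y ∈ S, delta y)
  rw [map_sum] at e
  change G.heat hA0 hA t (1 - ∑ y ∈ S, delta y) x =
    G.heat hA0 hA t 1 x - ∑ y ∈ S, G.heat hA0 hA t (delta y) x at e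
  rw [e, heat_one] at h
  simp only [G.heatKernel_eq_heat hA0 hA]
  linarith

theorem heatKernel_le_one (hA : ∀ x, G.deg x ≤ A * G.μ x) (hA0 : 0 ≤ A) {t : ℝ}
    (ht : 0 ≤ t) (x y : V) : G.heatKernel t x y ≤ 1 := by
  simpa using G.sum_heatKernel_le_one hA hA0 ht x {y}

/-! ### Symmetry of the heat kernel -/

theorem laplacian_delta (hw : ∀ a b, G.graph.Adj a b → G.w a b = G.w b a) (x : V) :
    G.laplacian (Set.indicator {x} fun _ => 1) =
      ∑ z ∈ G.nbrs x, G.w x z • ((G.μ z)⁻¹ • Set.indicator {z} (fun _ => (1 : ℝ)) -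
        (G.μ x)⁻¹ • Set.indicator {x} (fun _ => (1 : ℝ))) := by
  classical
  funext a
  simp only [laplacian, Finset.sum_apply, Pi.smul_apply, Pi.sub_apply, smul_eq_mul,
    Set.indicator_apply, Set.mem_singleton_iff]
  by_cases hax : a = x
  · subst hax
    rw [one_div, Finset.mul_sum]
    refine Finset.sum_congr rfl fun z hz => ?_
    have h := (mem_nbrs.1 hz).ne
    simp only [h, h.symm, if_true, if_false]
    ring
  · simp only [hax, if_false, mul_zero, sub_zero, mul_ite, mul_one]
    rw [Finset.sum_ite_eq', Finset.sum_ite_eq]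
    simp only [mem_nbrs, G.graph.adj_comm x a]
    split_ifs with h
    · rw [hw a x h]
      ring
    · simp

theorem laplacianHom_pow_apply (k : ℕ) (f : V → ℝ) :
    (G.laplacianHom ^ k) f = G.laplacian^[k] f := by
  rw [Module.End.pow_apply]
  rfl

/-- The kernels of the powers of the Laplacian are symmetric with respect to `μ`. -/
theorem iterate_laplacian_symm (hw : ∀ a b, G.graph.Adj a b → G.w a b = G.w b a) (k : ℕ) :
    ∀ x y, G.μ x * G.laplacian^[k] (Set.indicator {y} fun _ => 1) x =
      G.μ y * G.laplacian^[k] (Set.indicator {x} fun _ => 1) y := by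
  induction k with
  | zero =>
    intro x y
    by_cases hxy : x = y
    · rw [hxy]
    · simp [hxy, Ne.symm hxy]
  | succ k ih =>
    intro x y
    have hx := (G.μ_pos x).ne'
    rw [Function.iterate_succ_apply', Function.iterate_succ_apply, G.laplacian_delta hw,
      ← laplacianHom_pow_apply _ k (Finset.sum _ _), map_sum, laplacian, ← mul_assoc,
      mul_one_div_cancel hx, one_mul, Finset.sum_apply, Finset.mul_sum]
    refine Finset.sum_congr rfl fun z _ => ?_
    have hz := (G.μ_pos z).ne'
    rw [map_smul, map_sub, map_smul, map_smul, laplacianHom_pow_apply, laplacianHom_pow_apply]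
    simp only [Pi.smul_apply, Pi.sub_apply, smul_eq_mul]
    have h1 := ih z y
    have h2 := ih x y
    have e1 : G.laplacian^[k] (Set.indicator {y} fun _ => 1) z =
        (G.μ z)⁻¹ * (G.μ y * G.laplacian^[k] (Set.indicator {z} fun _ => 1) y) := by
      rw [← h1, inv_mul_cancel_left₀ hz]
    have e2 : G.laplacian^[k] (Set.indicator {y} fun _ => 1) x =
        (G.μ x)⁻¹ * (G.μ y * G.laplacian^[k] (Set.indicator {x} fun _ => 1) y) := by
      rw [← h2, inv_mul_cancel_left₀ hx]
    rw [e1, e2]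
    ring

theorem heatKernel_symm (hw : ∀ a b, G.graph.Adj a b → G.w a b = G.w b a) (t : ℝ) (x y : V) :
    G.μ x * G.heatKernel t x y = G.μ y * G.heatKernel t y x := by
  rw [heatKernel, heatKernel, ← tsum_mul_left, ← tsum_mul_left]
  refine tsum_congr fun k => ?_
  rw [mul_left_comm, G.iterate_laplacian_symm hw k x y, mul_left_comm]

end WeightedGraph

/-! ### Harnack inequality and bounds for the heat kernel -/

namespace WeightedGraph

variable {V : Type*}

/-- Harnack inequality along a walk, with the same amount of time `τ` spent on each edge. -/
theorem harnack_walk (G : WeightedGraph V) {n A c ε M : ℝ} (hn : 0 < n) (hA0 : 0 < A)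
    (hCDE : G.CDE n 0) (hA : ∀ x, G.deg x ≤ A * G.μ x) (hc : 0 < c)
    (hcw : ∀ x y, G.graph.Adj x y → c * G.μ x ≤ G.w x y) {u : ℝ → V → ℝ}
    (hu : ∀ t z, HasDerivAt (fun s => u s z) (G.laplacian (u t) z) t) (hε : 0 < ε)
    (hlow : ∀ t, 0 ≤ t → ∀ z, ε ≤ u t z) (hM : ∀ t, 0 ≤ t → ∀ z, u t z ≤ M)
    {τ : ℝ} (hτ : 0 < τ) {x y : V} (p : G.graph.Walk x y) :
    ∀ T : ℝ, 0 < T → Real.log (u T x) + n * Real.log T -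
      (Real.log (u (T + p.length * τ) y) + n * Real.log (T + p.length * τ)) ≤
        p.length * (4 / (c * τ)) := by
  induction p with
  | nil => intro T _; simp
  | @cons a b d hab q ih =>
    intro T hT
    have hly := fun t (ht : 0 < t) z =>
      G.gam_sqrt_sub_le_laplacian hn hA0 hCDE hA hu hε hlow hM ht z
    have hpos : ∀ t, 0 ≤ t → ∀ z, 0 < u t z := fun t ht z => hε.trans_le (hlow t ht z)
    have h1 := log_sub_le_of_sqrt_sub_sq_le_deriv (n := n) hc hT (by linarith : T < T + τ)
      (a := fun s => u s a) (b := fun s => u s b)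
      (fun s _ => hu s a) (fun s _ => hu s b)
      (fun s hs => hpos s (hT.le.trans hs.1) a) (fun s hs => hpos s (hT.le.trans hs.1) b)
      (fun s hs => by
        have h := hly s (hT.trans_le hs.1) a
        have := G.gam_self_nonneg (fun z => √(u s z)) a
        linarith)
      (fun s hs => by
        have h := hly s (hT.trans_le hs.1) b
        have := G.edge_le_gam hab.symm (hcw b a hab.symm) (fun z => √(u s z))
        linarith)
    have h2 := ih (T + τ) (by linarith)
    have e : T + τ + q.length * τ = T + (q.length + 1 : ℝ) * τ := by ring
    rw [e] at h2
    rw [SimpleGraph.Walk.length_cons, Nat.cast_add_one]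
    have e2 : T + τ - T = τ := by ring
    rw [e2] at h1
    linarith

/-- Harnack inequality for bounded nonnegative solutions of the heat equation. -/
theorem harnack (G : WeightedGraph V) {n A c M : ℝ} (hn : 0 < n) (hA0 : 0 < A)
    (hCDE : G.CDE n 0) (hA : ∀ x, G.deg x ≤ A * G.μ x) (hc : 0 < c)
    (hcw : ∀ x y, G.graph.Adj x y → c * G.μ x ≤ G.w x y) {u : ℝ → V → ℝ}
    (hu : ∀ t z, HasDerivAt (fun s => u s z) (G.laplacian (u t) z) t)
    (hnonneg : ∀ t, 0 ≤ t → ∀ z, 0 ≤ u t z) (hM : ∀ t, 0 ≤ t → ∀ z, u t z ≤ M)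
    {T₁ T₂ : ℝ} (hT₁ : 0 < T₁) (hT : T₁ < T₂) {x y : V} (hxy : G.graph.Reachable x y) :
    u T₁ x ≤ u T₂ y *
      ((T₂ / T₁) ^ n * Real.exp (4 / c * (G.graph.dist x y : ℝ) ^ 2 / (T₂ - T₁))) := by
  have hL : 0 < T₂ - T₁ := sub_pos.2 hT
  have hT₂ : 0 < T₂ := hT₁.trans hT
  set K := (T₂ / T₁) ^ n * Real.exp (4 / c * (G.graph.dist x y : ℝ) ^ 2 / (T₂ - T₁)) with hK
  have hKpos : 0 < K := mul_pos (Real.rpow_pos_of_pos (div_pos hT₂ hT₁) _) (Real.exp_pos _)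
  -- The gradient estimate needs a positive lower bound, which `u + ε` has.
  have main : ∀ ε, 0 < ε → u T₁ x + ε ≤ (u T₂ y + ε) * K := by
    intro ε hε
    have hu' : ∀ t z, HasDerivAt (fun s => u s z + ε) (G.laplacian (fun z => u t z + ε) z) t := by
      intro t z
      rw [laplacian_add, laplacian_const, add_zero]
      exact (hu t z).add_const ε
    have hlow' : ∀ t, 0 ≤ t → ∀ z, ε ≤ u t z + ε := fun t ht z => by linarith [hnonneg t ht z]
    have hM' : ∀ t, 0 ≤ t → ∀ z, u t z + ε ≤ M + ε := fun t ht z => by linarith [hM t ht z]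
    have hxpos : 0 < u T₁ x + ε := hε.trans_le (hlow' T₁ hT₁.le x)
    have hypos : 0 < u T₂ y + ε := hε.trans_le (hlow' T₂ hT₂.le y)
    have hlog : Real.log (u T₁ x + ε) + n * Real.log T₁ -
        (Real.log (u T₂ y + ε) + n * Real.log T₂) ≤
          4 / c * (G.graph.dist x y : ℝ) ^ 2 / (T₂ - T₁) := by
      obtain ⟨p, hp⟩ := hxy.exists_walk_length_eq_dist
      rcases Nat.eq_zero_or_pos (G.graph.dist x y) with h0 | h0
      · rw [h0] at hp
        obtain rfl := SimpleGraph.Walk.eq_of_length_eq_zero hp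
        have h := log_add_le_of_neg_div_le_deriv (n := n) hT₁ hT.le
          (a := fun s => u s x + ε) (fun s _ => hu' s x)
          (fun s hs => hε.trans_le (hlow' s (hT₁.le.trans hs.1) x))
          (fun s hs => by
            have h := G.gam_sqrt_sub_le_laplacian hn hA0 hCDE hA hu' hε hlow' hM'
              (hT₁.trans_le hs.1) x
            have := G.gam_self_nonneg (fun z => √(u s z + ε)) x
            linarith)
        rw [h0]
        simp only [Nat.cast_zero, ne_eq, OfNat.ofNat_ne_zero, not_false_eq_true, zero_pow,
          mul_zero, zero_div]
        linarith
      · have hk : (0 : ℝ) < G.graph.dist x y := Nat.cast_pos.2 h0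
        have h := G.harnack_walk hn hA0 hCDE hA hc hcw hu' hε hlow' hM'
          (div_pos hL hk) p T₁ hT₁
        rw [hp, mul_div_cancel₀ _ hk.ne', add_sub_cancel] at h
        refine h.trans (le_of_eq ?_)
        field_simp
    rw [← Real.log_le_log_iff hxpos (mul_pos hypos hKpos), Real.log_mul hypos.ne' hKpos.ne', hK,
      Real.log_mul (Real.rpow_pos_of_pos (div_pos hT₂ hT₁) _).ne' (Real.exp_pos _).ne',
      Real.log_exp, Real.log_rpow (div_pos hT₂ hT₁), Real.log_div hT₂.ne' hT₁.ne']
    linarith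
  refine le_of_forall_pos_le_add fun ε hε => ?_
  have h := main (ε / K) (div_pos hε hKpos)
  rw [add_mul, div_mul_cancel₀ _ hKpos.ne'] at h
  have := div_pos hε hKpos
  linarith

theorem heatKernel_harnack (G : WeightedGraph V) {n A c : ℝ} (hn : 0 < n) (hA0 : 0 < A)
    (hCDE : G.CDE n 0) (hA : ∀ x, G.deg x ≤ A * G.μ x) (hc : 0 < c)
    (hcw : ∀ x y, G.graph.Adj x y → c * G.μ x ≤ G.w x y)
    {T₁ T₂ : ℝ} (hT₁ : 0 < T₁) (hT : T₁ < T₂) {x z : V} (hxz : G.graph.Reachable x z) (y : V) :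
    G.heatKernel T₁ x y ≤ G.heatKernel T₂ z y *
      ((T₂ / T₁) ^ n * Real.exp (4 / c * (G.graph.dist x z : ℝ) ^ 2 / (T₂ - T₁))) :=
  G.harnack (u := fun t z => G.heatKernel t z y) hn hA0 hCDE hA hc hcw
    (fun t z => G.hasDerivAt_heatKernel hA hA0.le t z y)
    (fun _ ht z => G.heatKernel_nonneg hA hA0.le ht z y)
    (fun _ ht z => G.heatKernel_le_one hA hA0.le ht z y) hT₁ hT hxz

/-- Lower bound: the Harnack inequality compares `P_1(y, y) ≥ e^{-A}` with `P_t(x, y)`. -/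
theorem heatKernel_lower (G : WeightedGraph V) {n A c : ℝ} (hn : 0 < n) (hA0 : 0 < A)
    (hCDE : G.CDE n 0) (hA : ∀ x, G.deg x ≤ A * G.μ x) (hc : 0 < c)
    (hcw : ∀ x y, G.graph.Adj x y → c * G.μ x ≤ G.w x y) {t : ℝ} (ht : 1 < t) {x y : V}
    (hxy : G.graph.Reachable x y) :
    Real.exp (-A) * t ^ (-n) * Real.exp (-(4 / c) * (G.graph.dist x y : ℝ) ^ 2 / (t - 1)) ≤
      G.heatKernel t x y := by
  have h1 := G.heatKernel_harnack hn hA0 hCDE hA hc hcw one_pos ht hxy.symm y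
  have h2 := G.exp_le_heatKernel_self hA hA0.le zero_le_one y
  rw [one_mul] at h2
  rw [div_one, SimpleGraph.dist_comm] at h1
  have htn : 0 < t ^ n := Real.rpow_pos_of_pos (by linarith) _
  have e : Real.exp (-A) * t ^ (-n) *
      Real.exp (-(4 / c) * (G.graph.dist x y : ℝ) ^ 2 / (t - 1)) =
      Real.exp (-A) / (t ^ n * Real.exp (4 / c * (G.graph.dist x y : ℝ) ^ 2 / (t - 1))) := by
    rw [Real.rpow_neg (by linarith), neg_mul, neg_div, Real.exp_neg (4 / c * _ / _)]
    field_simp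
  rw [e, div_le_iff₀ (mul_pos htn (Real.exp_pos _))]
  exact h2.trans h1

/-- Upper bound: by the Harnack inequality `P_t(x, y)` is at most a constant times `P_{2t}(z, y)`
for all `z ∈ B(x, √t)`. Averaging over the ball and symmetry leave `∑_z P_{2t}(y, z) ≤ 1`. -/
theorem heatKernel_upper (G : WeightedGraph V) {n A c : ℝ} (hn : 0 < n) (hA0 : 0 < A)
    (hCDE : G.CDE n 0) (hA : ∀ x, G.deg x ≤ A * G.μ x) (hc : 0 < c)
    (hcw : ∀ x y, G.graph.Adj x y → c * G.μ x ≤ G.w x y)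
    (hw : ∀ a b, G.graph.Adj a b → G.w a b = G.w b a) {t : ℝ} (ht : 0 < t) (x y : V) :
    G.heatKernel t x y ≤ 2 ^ n * Real.exp (4 / c) * (G.μ y / G.volBall x (√t)) := by
  set K := (2 : ℝ) ^ n * Real.exp (4 / c) with hK
  have hKpos : 0 < K := by positivity
  have hx : x ∈ (G.finite_ball x (√t)).toFinset := by
    rw [Set.Finite.mem_toFinset]
    refine ⟨SimpleGraph.Reachable.refl _, ?_⟩
    rw [SimpleGraph.dist_self, Nat.cast_zero]
    exact Real.sqrt_nonneg t
  have hvol : 0 < G.volBall x (√t) := Finset.sum_pos (fun z _ => G.μ_pos z) ⟨x, hx⟩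
  have hz : ∀ z ∈ (G.finite_ball x (√t)).toFinset,
      G.heatKernel t x y * G.μ z ≤ K * G.μ y * G.heatKernel (2 * t) y z := by
    intro z hz
    rw [Set.Finite.mem_toFinset] at hz
    have h1 := G.heatKernel_harnack hn hA0 hCDE hA hc hcw ht (by linarith : t < 2 * t) hz.1 y
    have hd : (G.graph.dist x z : ℝ) ^ 2 ≤ t := by
      have := pow_le_pow_left₀ (Nat.cast_nonneg _) hz.2 2
      rwa [Real.sq_sqrt ht.le] at this
    have h2 : (2 * t / t) ^ n * Real.exp (4 / c * (G.graph.dist x z : ℝ) ^ 2 / (2 * t - t)) ≤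
        K := by
      rw [mul_div_cancel_right₀ _ ht.ne', hK]
      refine mul_le_mul_of_nonneg_left (Real.exp_le_exp.2 ?_) (by positivity)
      rw [show 2 * t - t = t by ring, div_le_iff₀ ht]
      exact mul_le_mul_of_nonneg_left hd (by positivity)
    have h3 := h1.trans (mul_le_mul_of_nonneg_left h2
      (G.heatKernel_nonneg hA hA0.le (by linarith : 0 ≤ 2 * t) z y))
    have h4 := mul_le_mul_of_nonneg_right h3 (G.μ_pos z).le
    have h5 := G.heatKernel_symm hw (2 * t) z y
    calc G.heatKernel t x y * G.μ z ≤ G.heatKernel (2 * t) z y * K * G.μ z := h4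
      _ = K * (G.μ z * G.heatKernel (2 * t) z y) := by ring
      _ = K * G.μ y * G.heatKernel (2 * t) y z := by rw [h5]; ring
  have hsum := Finset.sum_le_sum hz
  rw [← Finset.mul_sum, ← Finset.mul_sum] at hsum
  have h1 := G.sum_heatKernel_le_one hA hA0.le (by linarith : 0 ≤ 2 * t) y
    (G.finite_ball x (√t)).toFinset
  have h2 := mul_le_mul_of_nonneg_left h1 (mul_nonneg hKpos.le (G.μ_pos y).le)
  rw [← mul_div_assoc, le_div_iff₀ hvol]
  rw [mul_one] at h2
  exact hsum.trans h2

end WeightedGraph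

theorem mainTheorem6 (n D wmin μmax Dμ : ℝ) (hn : 0 < n) (hwmin : 0 < wmin) :
    ∃ C C' C'' : ℝ, 0 < C ∧ 0 < C' ∧ 0 < C'' ∧
      ∀ (V : Type*) (G : WeightedGraph V),
        G.CDE n 0 →
        (∀ x, G.deg x ≤ D) →
        (∀ x y, G.graph.Adj x y → wmin ≤ G.w x y) →
        (∀ x, G.μ x ≤ μmax) →
        (∀ x, G.deg x ≤ Dμ * G.μ x) →
        ∀ t : ℝ, 1 < t → ∀ x y : V,
          (G.graph.Reachable x y →
            C * t ^ (-n) * Real.exp (-C' * (G.graph.dist x y : ℝ) ^ 2 / (t - 1)) ≤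
              G.heatKernel t x y) ∧
          ((∀ a b, G.graph.Adj a b → G.w a b = G.w b a) →
            G.heatKernel t x y ≤ C'' * (G.μ y / G.volBall x (Real.sqrt t))) := by
  -- `|·| + 1` makes the bounds positive, as the given ones need not be when there are no vertices
  -- or no edges.
  set c := wmin / (|μmax| + 1) with hcdef
  have hc : 0 < c := by positivity
  refine ⟨Real.exp (-(|Dμ| + 1)), 4 / c, 2 ^ n * Real.exp (4 / c), Real.exp_pos _, by positivity,
    by positivity, ?_⟩
  intro V G hCDE _ hw hμ hdeg t ht x y
  have hA0 : 0 < |Dμ| + 1 := by positivity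
  have hA : ∀ x, G.deg x ≤ (|Dμ| + 1) * G.μ x := fun x =>
    (hdeg x).trans (mul_le_mul_of_nonneg_right (by linarith [le_abs_self Dμ]) (G.μ_pos x).le)
  have hcw : ∀ x y, G.graph.Adj x y → c * G.μ x ≤ G.w x y := fun x y hxy => by
    refine le_trans ?_ (hw x y hxy)
    rw [hcdef, div_mul_eq_mul_div, div_le_iff₀ (by positivity)]
    exact mul_le_mul_of_nonneg_left (by linarith [hμ x, le_abs_self μmax]) hwmin.le
  exact ⟨fun hxy => G.heatKernel_lower hn hA0 hCDE hA hc hcw ht hxy,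
    fun hsymm => G.heatKernel_upper hn hA0 hCDE hA hc hcw hsymm (by linarith) x y⟩
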